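/- Conventions. For a locally compact Hausdorff space $K$, let $M(K)$ be the space of regular complex Borel measures on $K$ and $M^+(K)$ the set of finite non-negative regular Borel measures, equipped with the cone topology, i.e. the weak topology induced by the non-negative functions in $C_c(K)$ together with the constant function $1$. Let $p_x$ be the point mass at $x$, and let $C(K)$ be the space of bounded continuous functions $K\to\mathbb{C}$ with the supremum norm. A semitopological semihypergroup is a non-empty locally compact Hausdorff space $K$ with a bilinear associative product $*$ on $M(K)$ such that: $*$ maps $M^+(K)\times M^+(K)$ into $M^+(K)$ and is separately continuous there; for all $x,y\in K$ the measure $p_x*p_y$ is a probability measure with compact support; and $(x,y)\mapsto\operatorname{supp}(p_x*p_y)$ is continuous from $K\times K$ to the space of compact subsets of $K$ with the Michael (Vietoris) topology. For $f\in C(K)$ put $L_xf(y)=R_yf(x)=\int_K f\,d(p_x*p_y)$. The function $f$ is almost periodic if $\{L_xf:x\in K\}$ or, equivalently, $\{R_yf:y\in K\}$ is relatively compact in $C(K)$; $AP(K)$ is the space of such functions. $AP(K)$ is left amenable if there is a bounded linear functional $m$ on $AP(K)$ with $\|m\|=m(1)=1$ and $m(L_xf)=m(f)$ for all $x\in K$,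 $f\in AP(K)$. An action of $K$ on a subset $C$ of a Hausdorff locally convex space $E$ is a map $\pi:K\times C\to C$ such that $\pi(s,\pi(t,x))=\int_K\pi(\zeta,x)\,d(p_s*p_t)(\zeta)$ (weak integral, tested against the continuous linear functionals on $E$) for all $s,t\in K$, $x\in C$, and such that $\pi(e,x)=x$ for all $x\in C$ whenever $e$ is a two-sided identity of $K$ (i.e. $p_x*p_e=p_e*p_x=p_x$ for all $x$). When $C$ is compact and convex, $\pi$ is affine if each $\pi_s=\pi(s,\cdot)$ is affine, and equicontinuous if for each $x\in C$ and each neighbourhood $U$ of the diagonal in $C\times C$ there is a neighbourhood $V$ of the diagonal such that $(\pi(s,x),\pi(s,y))\in U$ for all $s\in K$ whenever $(x,y)\in V$. Theorem. Let $K$ be a semitopological semihypergroup. Then $AP(K)$ is left amenable if and only if for every non-empty compact convex subset $C$ of a Hausdorff locally convex space $E$, every separately continuous, equicontinuous, affine action $\pi$ of $K$ on $C$ has a common fixed point, i.e. there is $x_0\in C$ with $\pi(s,x_0)=x_0$ for all $s\in K$. (The equivalence holds with $E$ ranging over real spaces, and also with $E$ ranging over complex spaces.) -/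

import Mathlib

open MeasureTheory Topology Filter Set
open scoped BoundedContinuousFunction CompactlySupported NNReal ENNReal

universe u v

namespace SemiHyp

section Measures

/-- On a finite measure dominated by a finite regular measure, regularity is inherited. -/
theorem regular_of_le {X : Type*} [TopologicalSpace X] [T2Space X] [MeasurableSpace X]
    [BorelSpace X] {μ ν : Measure X} [IsFiniteMeasure μ] (hμ : μ.Regular) (h : ν ≤ μ) :
    ν.Regular := by
  have : IsFiniteMeasure ν := isFiniteMeasure_of_le μ h
  have : ν.InnerRegularCompactLTTop := by
    refine ⟨?_⟩
    rintro s ⟨hs, -⟩ r hr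
    obtain ⟨ε, hε, hlt⟩ : ∃ ε : ℝ≥0∞, ε ≠ 0 ∧ r + ε < ν s := by
      obtain ⟨ε, hε, h2⟩ := ENNReal.lt_iff_exists_add_pos_lt.1 hr
      exact ⟨ε, by simpa using hε.ne', h2⟩
    obtain ⟨F, hF, hFc, hlt2⟩ := hs.exists_isCompact_sdiff_lt (μ := μ) (measure_ne_top _ _) hε
    refine ⟨F, hF, hFc, ?_⟩
    have h1 : ν s ≤ ν F + ν (s \ F) := by
      calc ν s ≤ ν (F ∪ (s \ F)) := measure_mono (by intro x hx; by_cases x ∈ F <;> simp_all)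
        _ ≤ _ := measure_union_le _ _
    have h2 : ν (s \ F) ≤ ε := (h _).trans hlt2.le
    have hεt : ε ≠ ∞ := by
      rintro rfl
      simp at hlt
    by_contra hcon
    have : ν s ≤ r + ε := h1.trans (add_le_add (not_lt.1 hcon) h2)
    exact absurd hlt (not_lt.2 this)
  infer_instance

theorem regular_add {X : Type*} [TopologicalSpace X] [T2Space X] [MeasurableSpace X]
    [BorelSpace X] {μ ν : Measure X} [IsFiniteMeasure μ] [IsFiniteMeasure ν]
    (hμ : μ.Regular) (hν : ν.Regular) : (μ + ν).Regular := by
  infer_instance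

/-- The total variation of a complex measure is finite. -/
theorem isFiniteMeasure_variation {X : Type*} [MeasurableSpace X] (m : ComplexMeasure X) :
    IsFiniteMeasure m.variation := by
  have h : m.variation ≤
      (ComplexMeasure.re m).totalVariation + (ComplexMeasure.im m).totalVariation := by
    refine VectorMeasure.variation_le_of_forall_enorm_le fun E _ => ?_
    have h1 := SignedMeasure.enorm_le_totalVariation (ComplexMeasure.re m) E
    have h2 := SignedMeasure.enorm_le_totalVariation (ComplexMeasure.im m) E
    refine le_trans ?_ (add_le_add h1 h2)
    have : m E = (((ComplexMeasure.re m E : ℝ)) : ℂ)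
        + ((ComplexMeasure.im m E : ℝ) : ℂ) * Complex.I := by
      exact (Complex.re_add_im (m E)).symm
    rw [this]
    refine (enorm_add_le _ _).trans (le_of_eq ?_)
    simp [enorm_eq_nnnorm]
  exact isFiniteMeasure_of_le _ h

/-- `M(X)`: the complex vector space of regular complex Borel measures, that is, of the complex
measures whose total variation is a regular measure. -/
noncomputable def RegMeasure (X : Type*) [TopologicalSpace X] [T2Space X] [MeasurableSpace X]
    [BorelSpace X] : Submodule ℂ (ComplexMeasure X) where
  carrier := {m | m.variation.Regular}
  zero_mem' := by
    change (VectorMeasure.variation (0 : ComplexMeasure X)).Regular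
    rw [VectorMeasure.variation_zero]
    infer_instance
  add_mem' := by
    intro a b ha hb
    have := isFiniteMeasure_variation a
    have := isFiniteMeasure_variation b
    exact regular_of_le (regular_add ha hb) VectorMeasure.variation_add_le
  smul_mem' := by
    intro c a ha
    have : a.variation.Regular := ha
    change (VectorMeasure.variation (c • a)).Regular
    rw [VectorMeasure.variation_smul]
    infer_instance

/-- `M⁺(X)`: the finite non-negative regular Borel measures. -/
@[ext]
structure PosMeasure (X : Type*) [TopologicalSpace X] [MeasurableSpace X] where
  /-- The underlying Borel measure. -/
  toMeasure : Measure X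
  isFiniteMeasure : IsFiniteMeasure toMeasure
  regular : toMeasure.Regular

namespace PosMeasure

variable {X : Type*} [TopologicalSpace X] [MeasurableSpace X]

instance (μ : PosMeasure X) : IsFiniteMeasure μ.1 := μ.isFiniteMeasure

instance (μ : PosMeasure X) : μ.1.Regular := μ.regular

/-- The cone topology on `M⁺(X)`: the weak topology induced by the non-negative compactly supported
continuous functions together with the constant function `1`. -/
noncomputable instance coneTopology : TopologicalSpace (PosMeasure X) :=
  (⨅ f : C_c(X, ℝ≥0), TopologicalSpace.induced (fun μ : PosMeasure X => ∫ x, (f x : ℝ) ∂μ.1)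
    inferInstance) ⊓
  TopologicalSpace.induced (fun μ : PosMeasure X => μ.1.real univ) inferInstance

theorem continuous_integral_cc (f : C_c(X, ℝ≥0)) :
    Continuous fun μ : PosMeasure X => ∫ x, (f x : ℝ) ∂μ.1 := by
  rw [continuous_iff_le_induced]
  exact inf_le_left.trans (iInf_le _ f)

theorem continuous_mass : Continuous fun μ : PosMeasure X => μ.1.real univ := by
  rw [continuous_iff_le_induced]
  exact inf_le_right

/-- The inclusion of `M⁺(X)` into `M(X)`. -/
noncomputable def toReg [T2Space X] [BorelSpace X] (μ : PosMeasure X) : RegMeasure X :=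
  ⟨SignedMeasure.toComplexMeasure μ.1.toSignedMeasure 0, by
    refine regular_of_le μ.regular (VectorMeasure.variation_le_of_forall_enorm_le fun E hE => ?_)
    have : (SignedMeasure.toComplexMeasure μ.1.toSignedMeasure 0) E = ((μ.1.real E : ℝ) : ℂ) := by
      rw [SignedMeasure.toComplexMeasure_apply,
        Measure.toSignedMeasure_apply_measurable hE]
      rfl
    rw [this]
    rw [← ofReal_norm, Complex.norm_real, Real.norm_of_nonneg measureReal_nonneg,
      ofReal_measureReal]⟩

theorem toReg_injective [T2Space X] [BorelSpace X] :
    Function.Injective (toReg : PosMeasure X → RegMeasure X) := by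
  intro μ ν h
  have h1 := congrArg (fun m : RegMeasure X => ComplexMeasure.re m.1) h
  have h2 : μ.1.toSignedMeasure = ν.1.toSignedMeasure := h1
  exact PosMeasure.ext (Measure.toSignedMeasure_eq_toSignedMeasure_iff.1 h2)

/-- The point mass `p_x`. -/
noncomputable def point [T2Space X] [BorelSpace X] (x : X) : PosMeasure X :=
  ⟨Measure.dirac x, inferInstance, by
    have : (Measure.dirac x : Measure X).InnerRegularCompactLTTop := by
      refine ⟨?_⟩
      rintro s ⟨hs, -⟩ r hr
      by_cases hx : x ∈ s
      · refine ⟨{x}, by simpa using hx, isCompact_singleton, ?_⟩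
        rw [Measure.dirac_apply' _ hs] at hr
        simpa [hx] using hr
      · rw [Measure.dirac_apply' _ hs] at hr
        simp [hx] at hr
    infer_instance⟩

theorem continuous_point [T2Space X] [BorelSpace X] :
    Continuous (point : X → PosMeasure X) := by
  rw [continuous_iff_coinduced_le]
  refine le_inf (le_iInf fun f => ?_) ?_
  · rw [← continuous_iff_coinduced_le, continuous_induced_rng]
    have : ((fun μ : PosMeasure X => ∫ x, (f x : ℝ) ∂μ.1) ∘ point) = fun x => (f x : ℝ) := by
      funext x
      simp [point]
    rw [this]
    exact NNReal.continuous_coe.comp f.continuous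
  · rw [← continuous_iff_coinduced_le, continuous_induced_rng]
    have : ((fun μ : PosMeasure X => μ.1.real univ) ∘ point) = fun _ => (1 : ℝ) := by
      funext x
      simp [point]
    rw [this]
    exact continuous_const

theorem lowerSemicontinuous_integral [T2Space X] [LocallyCompactSpace X] [BorelSpace X]
    (f : X →ᵇ ℝ) (hf : ∀ x, 0 ≤ f x) :
    LowerSemicontinuous fun μ : PosMeasure X => ∫ x, f x ∂μ.1 := by
  intro μ₀ c hc
  obtain ⟨δ, hδ, hδc⟩ : ∃ δ : ℝ, 0 < δ ∧ c + ‖f‖ * δ < ∫ x, f x ∂μ₀.1 := by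
    have h1 : (0 : ℝ) < ‖f‖ + 1 := by positivity
    have h2 : 0 < (∫ x, f x ∂μ₀.1) - c := sub_pos.2 hc
    refine ⟨((∫ x, f x ∂μ₀.1) - c) / (‖f‖ + 1), by positivity, ?_⟩
    have : ‖f‖ * (((∫ x, f x ∂μ₀.1) - c) / (‖f‖ + 1)) < (∫ x, f x ∂μ₀.1) - c := by
      rw [mul_div_assoc', div_lt_iff₀ h1]
      nlinarith
    linarith
  obtain ⟨F, -, hF, hFδ⟩ := (MeasurableSet.univ (α := X)).exists_isCompact_sdiff_lt (μ := μ₀.1)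
    (measure_ne_top _ _) (ε := ENNReal.ofReal δ) (by simpa using hδ)
  obtain ⟨φ, hφ1, -, hφc, hφ⟩ := exists_continuous_one_zero_of_isCompact hF isClosed_empty
    (disjoint_empty F)
  let g : C_c(X, ℝ≥0) :=
    ⟨⟨fun x => (f x * φ x).toNNReal, by fun_prop⟩, by
      refine hφc.mono' ?_
      refine subset_trans ?_ subset_closure
      intro x hx
      simp only [Function.mem_support] at hx ⊢
      intro h0
      exact hx (by simp [h0])⟩
  have hg : ∀ x, (g x : ℝ) = f x * φ x := fun x =>
    Real.coe_toNNReal _ (mul_nonneg (hf x) (hφ x).1)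
  have hfi : ∀ μ : PosMeasure X, Integrable (fun x => f x) μ.1 := fun μ => f.integrable μ.1
  have hgi : ∀ μ : PosMeasure X, Integrable (fun x => (g x : ℝ)) μ.1 := by
    intro μ
    refine (hfi μ).mono' (by fun_prop) (Eventually.of_forall fun x => ?_)
    rw [hg, Real.norm_of_nonneg (mul_nonneg (hf x) (hφ x).1)]
    exact mul_le_of_le_one_right (hf x) (hφ x).2
  have key : c < ∫ x, (g x : ℝ) ∂μ₀.1 := by
    have hle : ∀ x, f x - (g x : ℝ) ≤ (Fᶜ).indicator (fun _ => ‖f‖) x := by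
      intro x
      rw [hg]
      by_cases hx : x ∈ F
      · have : φ x = 1 := hφ1 hx
        simp [hx, this]
      · have h1 : f x ≤ ‖f‖ := (le_abs_self _).trans (f.norm_coe_le_norm x)
        have h2 := mul_nonneg (hf x) (hφ x).1
        simp only [mem_compl_iff, hx, not_false_eq_true, indicator_of_mem]
        linarith
    have h1 : ∫ x, (f x - (g x : ℝ)) ∂μ₀.1 ≤ ∫ x, (Fᶜ).indicator (fun _ => ‖f‖) x ∂μ₀.1 := by
      refine integral_mono ((hfi μ₀).sub (hgi μ₀)) ?_ hle
      exact (integrable_const _).indicator hF.measurableSet.compl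
    rw [integral_sub (hfi μ₀) (hgi μ₀), integral_indicator hF.measurableSet.compl,
      setIntegral_const, smul_eq_mul] at h1
    have h2 : μ₀.1.real Fᶜ ≤ δ := by
      rw [← compl_eq_univ_sdiff] at hFδ
      exact ENNReal.toReal_le_of_le_ofReal hδ.le hFδ.le
    have h3 : μ₀.1.real Fᶜ * ‖f‖ ≤ δ * ‖f‖ := by gcongr
    nlinarith
  have hev := (continuous_integral_cc g).continuousAt.eventually (lt_mem_nhds key)
  filter_upwards [hev] with μ hμ
  refine hμ.trans_le (integral_mono (hgi μ) (hfi μ) fun x => ?_)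
  change (g x : ℝ) ≤ f x
  rw [hg]
  exact mul_le_of_le_one_right (hf x) (hφ x).2

theorem continuous_integral_real [T2Space X] [LocallyCompactSpace X] [BorelSpace X]
    (f : X →ᵇ ℝ) : Continuous fun μ : PosMeasure X => ∫ x, f x ∂μ.1 := by
  have hlsc : ∀ f : X →ᵇ ℝ, LowerSemicontinuous fun μ : PosMeasure X => ∫ x, f x ∂μ.1 := by
    intro f
    have h1 := lowerSemicontinuous_integral (f + BoundedContinuousFunction.const X ‖f‖) (by
      intro x
      have := neg_le_of_abs_le (f.norm_coe_le_norm x)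
      simp only [BoundedContinuousFunction.coe_add, Pi.add_apply,
        BoundedContinuousFunction.const_apply]
      linarith)
    have h2 : Continuous fun μ : PosMeasure X => -(μ.1.real univ * ‖f‖) :=
      (continuous_mass.mul continuous_const).neg
    have h3 := h1.add h2.lowerSemicontinuous
    refine (congrArg LowerSemicontinuous (funext fun μ => ?_)).mp h3
    have : ∫ x, (f + BoundedContinuousFunction.const X ‖f‖) x ∂μ.1
        = ∫ x, f x ∂μ.1 + ∫ _, ‖f‖ ∂μ.1 :=
      integral_add (f.integrable μ.1) (integrable_const _)
    rw [this, integral_const, smul_eq_mul]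
    ring
  rw [continuous_iff_lower_upperSemicontinuous]
  refine ⟨hlsc f, ?_⟩
  have h := hlsc (-f)
  intro μ c hc
  have := h μ (-c) (by simpa [integral_neg] using hc)
  filter_upwards [this] with ν hν
  simpa [integral_neg] using hν

/-- Integration against a bounded continuous function is continuous for the cone topology. -/
theorem continuous_integral [T2Space X] [LocallyCompactSpace X] [BorelSpace X]
    (f : X →ᵇ ℂ) : Continuous fun μ : PosMeasure X => ∫ x, f x ∂μ.1 := by
  let re : X →ᵇ ℝ := BoundedContinuousFunction.ofNormedAddCommGroup (fun x => (f x).re)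
    (by fun_prop) ‖f‖ fun x => (Complex.abs_re_le_norm _).trans (f.norm_coe_le_norm x)
  let im : X →ᵇ ℝ := BoundedContinuousFunction.ofNormedAddCommGroup (fun x => (f x).im)
    (by fun_prop) ‖f‖ fun x => (Complex.abs_im_le_norm _).trans (f.norm_coe_le_norm x)
  have h : (fun μ : PosMeasure X => ∫ x, f x ∂μ.1) =
      fun μ => ((∫ x, re x ∂μ.1 : ℝ) : ℂ) + ((∫ x, im x ∂μ.1 : ℝ) : ℂ) * Complex.I := by
    funext μ
    exact (integral_re_add_im (𝕜 := ℂ) (f.integrable μ.1)).symm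
  rw [h]
  exact (Complex.continuous_ofReal.comp (continuous_integral_real re)).add
    ((Complex.continuous_ofReal.comp (continuous_integral_real im)).mul continuous_const)

end PosMeasure

end Measures

theorem exists_finite_net {ι E : Type*} [PseudoMetricSpace E] {g : ι → E}
    (h : TotallyBounded (range g)) {ε : ℝ} (hε : 0 < ε) :
    ∃ u : Finset ι, ∀ i, ∃ j ∈ u, dist (g i) (g j) < ε := by
  classical
  obtain ⟨t, hts, htf, ht⟩ := totallyBounded_iff_subset.1 h _ (Metric.dist_mem_uniformity hε)
  choose k hk using fun y : t => hts y.2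
  have := htf.fintype
  refine ⟨Finset.univ.image k, fun i => ?_⟩
  have hi := ht ⟨i, rfl⟩
  simp only [mem_iUnion] at hi
  obtain ⟨y, hy, hd⟩ := hi
  refine ⟨k ⟨y, hy⟩, Finset.mem_image_of_mem _ (Finset.mem_univ _), ?_⟩
  rw [hk ⟨y, hy⟩]
  exact hd

/-- If the rows of a bounded function of two variables form a relatively compact set in the supremum
norm, then so do its columns. -/
theorem isCompact_closure_range_of_transpose {X Y : Type*} [TopologicalSpace X]
    [TopologicalSpace Y] {a : X → Y →ᵇ ℂ} {b : Y → X →ᵇ ℂ} (hab : ∀ x y, b y x = a x y)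
    (ha : IsCompact (closure (range a))) : IsCompact (closure (range b)) := by
  have hta : TotallyBounded (range a) := ha.totallyBounded.subset subset_closure
  refine TotallyBounded.isCompact_of_isClosed (TotallyBounded.closure ?_) isClosed_closure
  refine Metric.totallyBounded_iff.2 fun ε hε => ?_
  obtain ⟨u, hu⟩ := exists_finite_net hta (show 0 < ε / 4 by positivity)
  have htc : TotallyBounded (range fun (y : Y) (i : u) => a i y) := by
    have hc : IsCompact (Set.pi univ fun i : u => Metric.closedBall (0 : ℂ) ‖a i‖) :=
      isCompact_univ_pi fun i => isCompact_closedBall _ _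
    refine hc.totallyBounded.subset ?_
    rintro _ ⟨y, rfl⟩ i -
    simpa using (a i).norm_coe_le_norm y
  obtain ⟨v, hv⟩ := exists_finite_net htc (show 0 < ε / 4 by positivity)
  refine ⟨b '' v, v.finite_toSet.image _, ?_⟩
  rintro _ ⟨y, rfl⟩
  obtain ⟨z, hz, hyz⟩ := hv y
  refine mem_biUnion (mem_image_of_mem b hz) ?_
  rw [Metric.mem_ball]
  refine lt_of_le_of_lt ((BoundedContinuousFunction.dist_le (C := 3 * (ε / 4))
    (by positivity)).2 fun x => ?_) (by linarith)
  obtain ⟨i, hi, hxi⟩ := hu x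
  rw [hab, hab]
  have h1 : dist (a x y) (a i y) ≤ ε / 4 :=
    (BoundedContinuousFunction.dist_coe_le_dist y).trans hxi.le
  have h2 : dist (a x z) (a i z) ≤ ε / 4 :=
    (BoundedContinuousFunction.dist_coe_le_dist z).trans hxi.le
  have h3 : dist (a i y) (a i z) ≤ ε / 4 :=
    (dist_le_pi_dist (fun i : u => a i y) (fun i : u => a i z) ⟨i, hi⟩).trans hyz.le
  calc dist (a x y) (a x z)
      ≤ dist (a x y) (a i y) + dist (a i y) (a i z) + dist (a i z) (a x z) :=
        dist_triangle4 _ _ _ _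
    _ ≤ 3 * (ε / 4) := by rw [dist_comm (a i z)]; linarith

/-- A semitopological semihypergroup structure on a locally compact Hausdorff space `K`: an
associative algebra structure on `M(K)` that maps `M⁺(K) × M⁺(K)` to `M⁺(K)`, separately continuously
for the cone topology, such that all `p_x * p_y` are probability measures with compact support and
`(x, y) ↦ supp (p_x * p_y)` is continuous for the Michael (Vietoris) topology on the compact
subsets. -/
structure SemitopologicalSemihypergroup (K : Type*) [TopologicalSpace K] [T2Space K]
    [LocallyCompactSpace K] [MeasurableSpace K] [BorelSpace K] where
  /-- The convolution on `M(K)`. -/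
  conv : RegMeasure K →ₗ[ℂ] RegMeasure K →ₗ[ℂ] RegMeasure K
  conv_assoc : ∀ l m n, conv (conv l m) n = conv l (conv m n)
  /-- The restriction of the convolution to `M⁺(K)`, with values in `M⁺(K)`; it is determined by
  `conv` because `M⁺(K) → M(K)` is injective. -/
  convPos : PosMeasure K → PosMeasure K → PosMeasure K
  toReg_convPos : ∀ μ ν, (convPos μ ν).toReg = conv μ.toReg ν.toReg
  continuous_convPos_left : ∀ ω, Continuous fun μ => convPos ω μ
  continuous_convPos_right : ∀ ω, Continuous fun μ => convPos μ ω
  isProbabilityMeasure : ∀ x y, IsProbabilityMeasure (convPos (.point x) (.point y)).1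
  isCompact_support : ∀ x y, IsCompact (convPos (.point x) (.point y)).1.support
  continuous_support : Continuous fun q : K × K =>
    (⟨(convPos (.point q.1) (.point q.2)).1.support, isCompact_support q.1 q.2⟩ :
      TopologicalSpace.Compacts K)

namespace SemitopologicalSemihypergroup

variable {K : Type*} [TopologicalSpace K] [T2Space K] [LocallyCompactSpace K] [MeasurableSpace K]
  [BorelSpace K] (S : SemitopologicalSemihypergroup K)

/-- The probability measure `p_x * p_y`. -/
noncomputable def pp (x y : K) : Measure K := (S.convPos (.point x) (.point y)).1

instance (x y : K) : IsProbabilityMeasure (S.pp x y) := S.isProbabilityMeasure x y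

theorem norm_integral_pp_le (f : K →ᵇ ℂ) (x y : K) : ‖∫ z, f z ∂(S.pp x y)‖ ≤ ‖f‖ := by
  refine (norm_integral_le_of_norm_le_const
    (Eventually.of_forall fun z => f.norm_coe_le_norm z)).trans (le_of_eq ?_)
  simp

/-- The left translate `L_x f (y) = ∫ f d(p_x * p_y)` of a bounded continuous function. -/
noncomputable def leftTranslate (x : K) (f : K →ᵇ ℂ) : K →ᵇ ℂ :=
  BoundedContinuousFunction.ofNormedAddCommGroup (fun y => ∫ z, f z ∂(S.pp x y))
    ((PosMeasure.continuous_integral f).comp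
      ((S.continuous_convPos_left _).comp PosMeasure.continuous_point))
    ‖f‖ (fun y => S.norm_integral_pp_le f x y)

/-- The right translate `R_y f (x) = ∫ f d(p_x * p_y)` of a bounded continuous function. -/
noncomputable def rightTranslate (y : K) (f : K →ᵇ ℂ) : K →ᵇ ℂ :=
  BoundedContinuousFunction.ofNormedAddCommGroup (fun x => ∫ z, f z ∂(S.pp x y))
    ((PosMeasure.continuous_integral f).comp
      ((S.continuous_convPos_right _).comp PosMeasure.continuous_point))
    ‖f‖ (fun x => S.norm_integral_pp_le f x y)

/-- The left orbit of `f` is relatively compact in the supremum norm. -/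
def IsLeftAlmostPeriodic (f : K →ᵇ ℂ) : Prop :=
  IsCompact (closure (range fun x => S.leftTranslate x f))

/-- The right orbit of `f` is relatively compact in the supremum norm. -/
def IsRightAlmostPeriodic (f : K →ᵇ ℂ) : Prop :=
  IsCompact (closure (range fun y => S.rightTranslate y f))

theorem isLeftAlmostPeriodic_iff_isRightAlmostPeriodic (f : K →ᵇ ℂ) :
    S.IsLeftAlmostPeriodic f ↔ S.IsRightAlmostPeriodic f :=
  ⟨fun h => isCompact_closure_range_of_transpose (fun _ _ => rfl) h,
    fun h => isCompact_closure_range_of_transpose (fun _ _ => rfl) h⟩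

theorem leftTranslate_add (x : K) (f g : K →ᵇ ℂ) :
    S.leftTranslate x (f + g) = S.leftTranslate x f + S.leftTranslate x g := by
  ext y
  exact integral_add (f.integrable _) (g.integrable _)

theorem leftTranslate_smul (x : K) (c : ℂ) (f : K →ᵇ ℂ) :
    S.leftTranslate x (c • f) = c • S.leftTranslate x f := by
  ext y
  exact integral_smul c _

theorem leftTranslate_one (x : K) : S.leftTranslate x 1 = 1 := by
  ext y
  change ∫ _, (1 : ℂ) ∂(S.pp x y) = 1
  simp

/-- `AP(K)`: the space of (left or, equivalently, right) almost periodic functions. -/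
noncomputable def AP : Submodule ℂ (K →ᵇ ℂ) where
  carrier := {f | S.IsLeftAlmostPeriodic f ∨ S.IsRightAlmostPeriodic f}
  zero_mem' := by
    left
    have h : (range fun x => S.leftTranslate x (0 : K →ᵇ ℂ)) ⊆ {0} := by
      rintro _ ⟨x, rfl⟩
      have := S.leftTranslate_smul x 0 0
      simpa using this
    exact isCompact_singleton.of_isClosed_subset isClosed_closure
      (closure_minimal h isClosed_singleton)
  add_mem' := by
    intro f g hf hg
    rw [mem_ofPred_eq, ← isLeftAlmostPeriodic_iff_isRightAlmostPeriodic, or_self] at hf hg ⊢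
    have hc := IsCompact.add hf hg
    refine hc.of_isClosed_subset isClosed_closure (closure_minimal ?_ hc.isClosed)
    rintro _ ⟨x, rfl⟩
    refine ⟨_, subset_closure ⟨x, rfl⟩, _, subset_closure ⟨x, rfl⟩, ?_⟩
    exact (S.leftTranslate_add x f g).symm
  smul_mem' := by
    intro c f hf
    rw [mem_ofPred_eq, ← isLeftAlmostPeriodic_iff_isRightAlmostPeriodic, or_self] at hf ⊢
    have hc := IsCompact.smul c hf
    refine hc.of_isClosed_subset isClosed_closure (closure_minimal ?_ hc.isClosed)
    rintro _ ⟨x, rfl⟩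
    exact ⟨_, subset_closure ⟨x, rfl⟩, (S.leftTranslate_smul x c f).symm⟩

theorem one_mem_AP : (1 : K →ᵇ ℂ) ∈ S.AP := by
  left
  have h : (range fun x => S.leftTranslate x (1 : K →ᵇ ℂ)) ⊆ {1} := by
    rintro _ ⟨x, rfl⟩
    exact S.leftTranslate_one x
  exact isCompact_singleton.of_isClosed_subset isClosed_closure
    (closure_minimal h isClosed_singleton)

/-- A mean on `AP(K)`: a bounded linear functional `m` with `‖m‖ = 1 = m(1)`. -/
def IsMean (m : S.AP →L[ℂ] ℂ) : Prop :=
  ‖m‖ = 1 ∧ m ⟨1, S.one_mem_AP⟩ = 1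

/-- `m(L_x f) = m(f)` for all `x ∈ K` and `f ∈ AP(K)`. -/
def IsLeftInvariant (m : S.AP →L[ℂ] ℂ) : Prop :=
  ∀ (x : K) (f g : S.AP), (g : K →ᵇ ℂ) = S.leftTranslate x f → m g = m f

/-- `AP(K)` is left amenable: it admits a left invariant mean. -/
def LeftAmenableAP : Prop :=
  ∃ m : S.AP →L[ℂ] ℂ, S.IsMean m ∧ S.IsLeftInvariant m

/-- `e` is a two-sided identity. -/
def IsIdentity (e : K) : Prop :=
  ∀ x, S.pp x e = Measure.dirac x ∧ S.pp e x = Measure.dirac x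

end SemitopologicalSemihypergroup

/-- `v` is the weak (Pettis) integral of `f` with respect to `μ`: for every continuous linear
functional `φ`, the function `φ ∘ f` is integrable with integral `φ v`. -/
def HasWeakIntegral (𝕜 : Type*) [RCLike 𝕜] {X E : Type*} [MeasurableSpace X] [AddCommGroup E]
    [Module 𝕜 E] [TopologicalSpace E] (μ : Measure X) (f : X → E) (v : E) : Prop :=
  ∀ φ : E →L[𝕜] 𝕜, Integrable (fun x => φ (f x)) μ ∧ ∫ x, φ (f x) ∂μ = φ v

section Actions

variable {K : Type*} [TopologicalSpace K] [T2Space K] [LocallyCompactSpace K] [MeasurableSpace K]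
  [BorelSpace K]

/-- `π` is an action of the semihypergroup on the subset `C` of `E`:
`π(s, π(t, x)) = ∫ π(ζ, x) d(p_s * p_t)(ζ)`, and a two-sided identity, if there is one, acts as the
identity map. -/
structure IsAction (𝕜 : Type*) [RCLike 𝕜] (S : SemitopologicalSemihypergroup K) {E : Type*}
    [AddCommGroup E] [Module 𝕜 E] [TopologicalSpace E] {C : Set E} (π : K → C → C) : Prop where
  integral : ∀ (s t : K) (x : C),
    HasWeakIntegral 𝕜 (S.pp s t) (fun ζ => (π ζ x : E)) (π s (π t x) : E)
  identity : ∀ e, S.IsIdentity e → ∀ x, π e x = x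

/-- Separate continuity. -/
def IsSeparatelyContinuous {C : Type*} [TopologicalSpace C] (π : K → C → C) : Prop :=
  (∀ s, Continuous fun x => π s x) ∧ ∀ x, Continuous fun s => π s x

/-- Every `π_s` is affine on the (convex) set `C`. -/
def IsAffineAction {E : Type*} [AddCommGroup E] [Module ℝ E] {C : Set E} (π : K → C → C) : Prop :=
  ∀ (s : K) (x y z : C) (a b : ℝ), 0 ≤ a → 0 ≤ b → a + b = 1 →
    (z : E) = a • (x : E) + b • (y : E) → (π s z : E) = a • (π s x : E) + b • (π s y : E)

/-- Equicontinuity for the unique uniformity of a compact Hausdorff space `C`, whose entourages are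
the neighbourhoods of the diagonal. -/
def IsEquicontinuousAction {C : Type*} [TopologicalSpace C] (π : K → C → C) : Prop :=
  ∀ x : C, ∀ U ∈ 𝓝ˢ (diagonal C), ∃ V ∈ 𝓝ˢ (diagonal C),
    ∀ y, (x, y) ∈ V → ∀ s, (π s x, π s y) ∈ U

/-- Every separately continuous, equicontinuous, affine action of the semihypergroup on a nonempty
compact convex subset of a Hausdorff locally convex space over `𝕜` has a common fixed point. -/
def FixedPointProperty (𝕜 : Type) [RCLike 𝕜] {K : Type u} [TopologicalSpace K] [T2Space K]
    [LocallyCompactSpace K] [MeasurableSpace K] [BorelSpace K]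
    (S : SemitopologicalSemihypergroup K) : Prop :=
  ∀ (E : Type v) [AddCommGroup E] [Module 𝕜 E] [Module ℝ E] [IsScalarTower ℝ 𝕜 E]
    [TopologicalSpace E] [IsTopologicalAddGroup E] [ContinuousSMul 𝕜 E] [LocallyConvexSpace ℝ E]
    [T2Space E] (C : Set E), C.Nonempty → IsCompact C → Convex ℝ C →
    ∀ π : K → C → C, IsAction 𝕜 S π → IsSeparatelyContinuous π → IsEquicontinuousAction π →
      IsAffineAction π → ∃ x : C, ∀ s, π s x = x

end Actions

end SemiHyp

namespace SemiHyp

/-! Invariant means and fixed points determine each other. Given an invariant mean m and a point x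
of C, the map ψ ↦ Re m(s ↦ ψ(π_s x)) is a normalized positive functional on the continuous affine
functions on C, hence evaluation at some x₀ in C (`exists_forall_affine_eq`). Invariance of m gives
ψ(π_t x₀) = ψ(x₀) for every continuous linear ψ, and these separate points. Equicontinuity is what
puts s ↦ ψ(π_s x) into AP(K): right translation by t replaces x by π_t x, so the right orbit lies in
a norm-continuous image of C.

Conversely, K acts on the compact convex set of means by transposed left translation, and a common
fixed point is an invariant mean. Relative compactness of orbits in AP(K) supplies both
equicontinuity and continuity in s.

Two points need care. Convolution is only separately continuous on the cone, so (p_s * p_t) * p_y is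
not given as an integral of the p_z * p_y; tested against bounded continuous functions it is one,
because the point masses generate M⁺(K) as a closed convex cone (`mem_of_isClosed_of_comb`). And an
action is tested against linear functionals only, while ψ ∘ π_t is merely affine;
`exists_functional_near_affine` bridges this. Means are kept as real-valued points of a power of 𝕜,
so that one construction serves real and complex spaces. -/

/-- A continuous linear functional on a power of the scalar field is a finite linear combination of
coordinates. -/
theorem exists_finset_sum_coord {ι 𝕜 : Type*} [RCLike 𝕜] (φ : (ι → 𝕜) →L[𝕜] 𝕜) :
    ∃ (J : Finset ι) (c : ι → 𝕜), ∀ x, φ x = ∑ j ∈ J, x j * c j := by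
  classical
  have h0 : φ ⁻¹' Metric.ball 0 1 ∈ 𝓝 (0 : ι → 𝕜) :=
    φ.continuous.continuousAt.preimage_mem_nhds (by simpa using Metric.ball_mem_nhds 0 one_pos)
  rw [nhds_pi, Filter.mem_pi] at h0
  obtain ⟨I, hI, t, ht, hIt⟩ := h0
  -- A vector vanishing on `I` stays in the basic neighbourhood under every scaling, yet scaling by
  -- `(φ x)⁻¹` would give `φ` the value 1, outside the open unit ball.
  have hker : ∀ x : ι → 𝕜, (∀ j ∈ I, x j = 0) → φ x = 0 := by
    intro x hx
    by_contra hne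
    have hmem : (φ x)⁻¹ • x ∈ φ ⁻¹' Metric.ball 0 1 := by
      refine hIt fun j hj => ?_
      simpa [hx j hj] using mem_of_mem_nhds (ht j)
    simp [hne] at hmem
  refine ⟨hI.toFinset, fun j => φ (Pi.single j 1), fun x => ?_⟩
  have h1 : φ (x - ∑ j ∈ hI.toFinset, x j • Pi.single j (1 : 𝕜)) = 0 := by
    refine hker _ fun j hj => ?_
    simp [Finset.sum_apply, Pi.single_apply, hj]
  rw [map_sub, sub_eq_zero, map_sum] at h1
  simpa using h1

/-! ### The cone of positive measures and its point masses -/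

namespace PosMeasure

section Comb

variable {X : Type*} [TopologicalSpace X] [MeasurableSpace X]

/-- The combination `a μ + b ν` in the cone `M⁺(X)`. -/
noncomputable def comb [T2Space X] [BorelSpace X] (a b : ℝ≥0) (μ ν : PosMeasure X) :
    PosMeasure X :=
  ⟨a • μ.1 + b • ν.1, inferInstance, inferInstance⟩

theorem integral_comb [T2Space X] [BorelSpace X] (a b : ℝ≥0) (μ ν : PosMeasure X)
    {F : Type*} [NormedAddCommGroup F] [NormedSpace ℝ F] (f : X → F)
    (hμ : Integrable f μ.1) (hν : Integrable f ν.1) :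
    ∫ x, f x ∂(comb a b μ ν).1 = (a : ℝ) • ∫ x, f x ∂μ.1 + (b : ℝ) • ∫ x, f x ∂ν.1 := by
  have h1 : Integrable f (a • μ.1) := hμ.smul_measure_nnreal
  have h2 : Integrable f (b • ν.1) := hν.smul_measure_nnreal
  change ∫ x, f x ∂(a • μ.1 + b • ν.1) = _
  rw [integral_add_measure h1 h2, integral_smul_nnreal_measure, integral_smul_nnreal_measure]
  rfl

theorem toReg_comb [T2Space X] [BorelSpace X] (a b : ℝ≥0) (μ ν : PosMeasure X) :
    (comb a b μ ν).toReg = ((a : ℝ) : ℂ) • μ.toReg + ((b : ℝ) : ℂ) • ν.toReg := by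
  refine Subtype.ext (VectorMeasure.ext fun E hE => ?_)
  have h : ∀ ρ : PosMeasure X, ρ.toReg.1 E = ((ρ.1.real E : ℝ) : ℂ) := by
    intro ρ
    change (SignedMeasure.toComplexMeasure ρ.1.toSignedMeasure 0) E = _
    rw [SignedMeasure.toComplexMeasure_apply, Measure.toSignedMeasure_apply_measurable hE]
    rfl
  have h2 : (comb a b μ ν).1.real E = a * μ.1.real E + b * ν.1.real E := by
    change (a • μ.1 + b • ν.1).real E = _
    rw [measureReal_add_apply, measureReal_nnreal_smul_apply, measureReal_nnreal_smul_apply]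
  change _ = ((a : ℝ) : ℂ) • μ.toReg.1 E + ((b : ℝ) : ℂ) • ν.toReg.1 E
  rw [h, h, h, h2]
  simp

/-- The coordinates defining the cone topology. -/
noncomputable def coneCoord (μ : PosMeasure X) : Option C_c(X, ℝ≥0) → ℝ
  | none => μ.1.real univ
  | some f => ∫ x, (f x : ℝ) ∂μ.1

theorem isInducing_coneCoord : IsInducing (coneCoord : PosMeasure X → _) := by
  refine ⟨?_⟩
  change _ = TopologicalSpace.induced coneCoord (⨅ i, _)
  rw [induced_iInf, iInf_option]
  simp only [induced_compose]
  exact inf_comm _ _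

theorem integrable_cc [OpensMeasurableSpace X] (f : C_c(X, ℝ≥0)) (μ : PosMeasure X) :
    Integrable (fun x => (f x : ℝ)) μ.1 := by
  have hc : HasCompactSupport (fun x => (f x : ℝ)) :=
    f.hasCompactSupport.comp_left (g := fun r : ℝ≥0 => (r : ℝ)) rfl
  exact (NNReal.continuous_coe.comp f.continuous).integrable_of_hasCompactSupport hc

/-- A closed convex cone in `M⁺(X)` containing all point masses is everything. -/
theorem mem_of_isClosed_of_comb [T2Space X] [BorelSpace X] [Nonempty X] {A : Set (PosMeasure X)}
    (hA : IsClosed A) (hp : ∀ x, point x ∈ A)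
    (hc : ∀ (a b : ℝ≥0) (μ ν : PosMeasure X), μ ∈ A → ν ∈ A → comb a b μ ν ∈ A)
    (μ : PosMeasure X) : μ ∈ A := by
  have hcoord : ∀ (a b : ℝ≥0) (μ ν : PosMeasure X),
      coneCoord (comb a b μ ν) = (a : ℝ) • coneCoord μ + (b : ℝ) • coneCoord ν := by
    intro a b μ ν
    funext i
    rcases i with _ | f
    · have := integral_comb a b μ ν (fun _ => (1 : ℝ)) (integrable_const _) (integrable_const _)
      simpa [coneCoord] using this
    · exact integral_comb a b μ ν _ (integrable_cc f μ) (integrable_cc f ν)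
  have hconv : Convex ℝ (coneCoord '' A) := by
    rintro _ ⟨ν, hν, rfl⟩ _ ⟨ρ, hρ, rfl⟩ a b ha hb -
    exact ⟨comb ⟨a, ha⟩ ⟨b, hb⟩ ν ρ, hc _ _ _ _ hν hρ, hcoord _ _ _ _⟩
  rw [← hA.closure_eq, isInducing_coneCoord.closure_eq_preimage_closure_image, mem_preimage]
  by_contra hmem
  obtain ⟨φ, r, hφA, hφμ⟩ := geometric_hahn_banach_closed_point hconv.closure isClosed_closure hmem
  obtain ⟨J, c, hJ⟩ := exists_finset_sum_coord φ
  let k : Option C_c(X, ℝ≥0) → X → ℝ := fun i x => i.elim 1 fun f => (f x : ℝ)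
  have hkint : ∀ (ν : PosMeasure X) (i : Option C_c(X, ℝ≥0)), Integrable (k i) ν.1 := by
    rintro ν (_ | f)
    · exact integrable_const _
    · exact integrable_cc f ν
  have hk : ∀ (ν : PosMeasure X) i, coneCoord ν i = ∫ x, k i x ∂ν.1 := by
    rintro ν (_ | f)
    · simp [coneCoord, k]
    · rfl
  -- The separating functional involves finitely many coordinates, so on the cone it is integration
  -- of one function ∑ c_j k_j. Scaled point masses force this function to be ≤ 0, whereas its
  -- integral against `μ` exceeds `r > 0`.
  have hφ : ∀ ν : PosMeasure X, φ (coneCoord ν) = ∫ x, ∑ j ∈ J, k j x * c j ∂ν.1 := by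
    intro ν
    rw [hJ, integral_finsetSum _ fun j _ => (hkint ν j).mul_const _]
    exact Finset.sum_congr rfl fun j _ => by rw [hk, integral_mul_const]
  have hlt : ∀ (x : X) (a : ℝ≥0), a * ∑ j ∈ J, k j x * c j < r := by
    intro x a
    have h1 := hφA _ (subset_closure ⟨_, hc a 0 _ _ (hp x) (hp x), rfl⟩)
    rw [hcoord, map_add, map_smul, map_smul, hφ] at h1
    simpa [point] using h1
  have hr : 0 < r := by simpa using hlt (Classical.arbitrary X) 0
  have hneg : ∀ x, ∑ j ∈ J, k j x * c j ≤ 0 := by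
    intro x
    by_contra! hpos
    -- This multiple of the point mass makes the functional equal to `r`, against the strict bound.
    have := hlt x (r / ∑ j ∈ J, k j x * c j).toNNReal
    rw [Real.coe_toNNReal _ (by positivity), div_mul_cancel₀ _ hpos.ne'] at this
    exact lt_irrefl _ this
  rw [hφ] at hφμ
  exact absurd (hφμ.trans_le (integral_nonpos hneg)) hr.not_gt

end Comb

end PosMeasure

/-! ### Convolution, translations and almost periodic functions -/

namespace SemitopologicalSemihypergroup

variable {K : Type*} [TopologicalSpace K] [T2Space K] [LocallyCompactSpace K] [MeasurableSpace K]
  [BorelSpace K] (S : SemitopologicalSemihypergroup K)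

open PosMeasure

theorem convPos_assoc (μ ν ρ : PosMeasure K) :
    S.convPos (S.convPos μ ν) ρ = S.convPos μ (S.convPos ν ρ) := by
  apply toReg_injective
  simp only [S.toReg_convPos, S.conv_assoc]

theorem convPos_comb_right (ω : PosMeasure K) (a b : ℝ≥0) (μ ν : PosMeasure K) :
    S.convPos ω (comb a b μ ν) = comb a b (S.convPos ω μ) (S.convPos ω ν) := by
  apply toReg_injective
  simp only [S.toReg_convPos, toReg_comb, map_add, map_smul]

theorem convPos_comb_left (ω : PosMeasure K) (a b : ℝ≥0) (μ ν : PosMeasure K) :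
    S.convPos (comb a b μ ν) ω = comb a b (S.convPos μ ω) (S.convPos ν ω) := by
  apply toReg_injective
  simp only [S.toReg_convPos, toReg_comb, map_add, map_smul, LinearMap.add_apply,
    LinearMap.smul_apply]

theorem mem_AP_iff_left {f : K →ᵇ ℂ} : f ∈ S.AP ↔ S.IsLeftAlmostPeriodic f := by
  change _ ∨ _ ↔ _
  rw [← isLeftAlmostPeriodic_iff_isRightAlmostPeriodic, or_self]

theorem mem_AP_iff_right {f : K →ᵇ ℂ} : f ∈ S.AP ↔ S.IsRightAlmostPeriodic f := by
  rw [mem_AP_iff_left, isLeftAlmostPeriodic_iff_isRightAlmostPeriodic]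

theorem norm_leftTranslate_le (x : K) (f : K →ᵇ ℂ) : ‖S.leftTranslate x f‖ ≤ ‖f‖ :=
  BoundedContinuousFunction.norm_ofNormedAddCommGroup_le _ (norm_nonneg _) _

theorem leftTranslate_sub (x : K) (f g : K →ᵇ ℂ) :
    S.leftTranslate x (f - g) = S.leftTranslate x f - S.leftTranslate x g := by
  ext y
  exact integral_sub (f.integrable _) (g.integrable _)

theorem continuous_leftTranslate (x : K) : Continuous (S.leftTranslate x) := by
  refine (LipschitzWith.of_dist_le_mul (K := 1) fun f g => ?_).continuous
  rw [dist_eq_norm, dist_eq_norm, ← leftTranslate_sub, NNReal.coe_one, one_mul]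
  exact S.norm_leftTranslate_le x _

/-- The orbit map of an almost periodic function is continuous for the supremum norm. -/
theorem continuous_leftTranslate_of_mem_AP {f : K →ᵇ ℂ} (hf : f ∈ S.AP) :
    Continuous fun x => S.leftTranslate x f := by
  rw [mem_AP_iff_left] at hf
  have : CompactSpace (closure (range fun x => S.leftTranslate x f)) :=
    isCompact_iff_compactSpace.1 hf
  -- On the norm-compact orbit closure the norm topology coincides with that of pointwise
  -- convergence, and pointwise in y the orbit map is the continuous function R_y f.
  have hj : IsClosedEmbedding
      fun h : closure (range fun x => S.leftTranslate x f) => ((h : K →ᵇ ℂ) : K → ℂ) := by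
    refine Continuous.isClosedEmbedding ?_ ?_
    · exact BoundedContinuousFunction.continuous_coe.comp continuous_subtype_val
    · exact DFunLike.coe_injective.comp Subtype.val_injective
  have h : Continuous fun x : K =>
      (⟨S.leftTranslate x f, subset_closure ⟨x, rfl⟩⟩ :
        closure (range fun x => S.leftTranslate x f)) := by
    rw [hj.continuous_iff]
    exact continuous_pi fun y => (S.rightTranslate y f).continuous
  exact continuous_subtype_val.comp h

variable [Nonempty K]

/-- Both sides are continuous in `μ`, respect nonnegative combinations, and agree at point masses by
definition of the translate; `mem_of_isClosed_of_comb` does the rest. -/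
theorem integral_convPos_point_left (s : K) (f : K →ᵇ ℂ) (μ : PosMeasure K) :
    ∫ z, f z ∂(S.convPos (point s) μ).1 = ∫ z, S.leftTranslate s f z ∂μ.1 := by
  refine mem_of_isClosed_of_comb (A := {μ | ∫ z, f z ∂(S.convPos (point s) μ).1
    = ∫ z, S.leftTranslate s f z ∂μ.1}) (isClosed_eq ((continuous_integral f).comp
    (S.continuous_convPos_left _)) (continuous_integral _)) (fun x => ?_) ?_ μ
  · change _ = ∫ z, S.leftTranslate s f z ∂(Measure.dirac x)
    rw [integral_dirac]
    rfl
  · intro a b μ ν hμ hν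
    rw [mem_ofPred_eq] at hμ hν ⊢
    rw [S.convPos_comb_right, integral_comb _ _ _ _ _ (f.integrable _) (f.integrable _), hμ, hν,
      integral_comb _ _ _ _ _ (BoundedContinuousFunction.integrable _ _)
        (BoundedContinuousFunction.integrable _ _)]

theorem integral_convPos_point_right (s : K) (f : K →ᵇ ℂ) (μ : PosMeasure K) :
    ∫ z, f z ∂(S.convPos μ (point s)).1 = ∫ z, S.rightTranslate s f z ∂μ.1 := by
  refine mem_of_isClosed_of_comb (A := {μ | ∫ z, f z ∂(S.convPos μ (point s)).1
    = ∫ z, S.rightTranslate s f z ∂μ.1}) (isClosed_eq ((continuous_integral f).comp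
    (S.continuous_convPos_right _)) (continuous_integral _)) (fun x => ?_) ?_ μ
  · change _ = ∫ z, S.rightTranslate s f z ∂(Measure.dirac x)
    rw [integral_dirac]
    rfl
  · intro a b μ ν hμ hν
    rw [mem_ofPred_eq] at hμ hν ⊢
    rw [S.convPos_comb_left, integral_comb _ _ _ _ _ (f.integrable _) (f.integrable _), hμ, hν,
      integral_comb _ _ _ _ _ (BoundedContinuousFunction.integrable _ _)
        (BoundedContinuousFunction.integrable _ _)]

/-- This is p_s * (p_t * p_y) = (p_s * p_t) * p_y tested against `f`. -/
theorem integral_leftTranslate_pp (s t y : K) (f : K →ᵇ ℂ) :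
    ∫ z, S.leftTranslate s f z ∂(S.pp t y) = ∫ z, S.rightTranslate y f z ∂(S.pp s t) := by
  change ∫ z, _ ∂(S.convPos (point t) (point y)).1 = ∫ z, _ ∂(S.convPos (point s) (point t)).1
  rw [← integral_convPos_point_left, ← integral_convPos_point_right, convPos_assoc]

theorem rightTranslate_leftTranslate (s y : K) (f : K →ᵇ ℂ) :
    S.rightTranslate y (S.leftTranslate s f) = S.leftTranslate s (S.rightTranslate y f) := by
  ext x
  exact S.integral_leftTranslate_pp s x y f

theorem leftTranslate_leftTranslate_apply (s t y : K) (f : K →ᵇ ℂ) :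
    S.leftTranslate t (S.leftTranslate s f) y = ∫ z, S.leftTranslate z f y ∂(S.pp s t) :=
  S.integral_leftTranslate_pp s t y f

/-- Left translation commutes with right translations, so it maps the right orbit of `f` onto that
of its translate; being norm continuous, it preserves relative compactness. -/
theorem leftTranslate_mem_AP (s : K) {f : K →ᵇ ℂ} (hf : f ∈ S.AP) :
    S.leftTranslate s f ∈ S.AP := by
  rw [mem_AP_iff_right] at hf ⊢
  have hc := IsCompact.image hf (S.continuous_leftTranslate s)
  refine hc.of_isClosed_subset isClosed_closure (closure_minimal ?_ hc.isClosed)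
  rintro _ ⟨y, rfl⟩
  exact ⟨_, subset_closure ⟨y, rfl⟩, (S.rightTranslate_leftTranslate s y f).symm⟩

end SemitopologicalSemihypergroup

/-! ### Continuous affine functions on a compact convex set -/

section AffineFunctions

variable {E : Type*} [AddCommGroup E] [Module ℝ E] [TopologicalSpace E]

/-- The space `A(C)` of continuous real affine functions on `C`. -/
def affineFunctions (C : Set E) : Submodule ℝ C(C, ℝ) where
  carrier := {ψ | ∀ (x y z : C) (a b : ℝ), 0 ≤ a → 0 ≤ b → a + b = 1 →
    (z : E) = a • (x : E) + b • (y : E) → ψ z = a * ψ x + b * ψ y}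
  zero_mem' := by simp
  add_mem' := by
    intro ψ χ hψ hχ x y z a b ha hb hab hz
    simp only [ContinuousMap.add_apply, hψ x y z a b ha hb hab hz, hχ x y z a b ha hb hab hz]
    ring
  smul_mem' := by
    intro c ψ hψ x y z a b ha hb hab hz
    simp only [ContinuousMap.smul_apply, smul_eq_mul, hψ x y z a b ha hb hab hz]
    ring

/-- The restriction of a continuous linear functional to `C`. -/
def restrictFunctional (C : Set E) (φ : E →L[ℝ] ℝ) : affineFunctions C :=
  ⟨⟨fun x => φ x, by fun_prop⟩, fun x y z a b _ _ _ hz => by simp [hz]⟩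

variable [IsTopologicalAddGroup E] [ContinuousSMul ℝ E] [LocallyConvexSpace ℝ E] [T2Space E]

/-- Continuous affine functions on a compact convex set are uniform limits of restrictions of
continuous linear functionals plus constants. -/
theorem exists_functional_near_affine {C : Set E} (hC : IsCompact C) (hconv : Convex ℝ C)
    (ψ : affineFunctions C) {ε : ℝ} (hε : 0 < ε) :
    ∃ (φ : E →L[ℝ] ℝ) (c : ℝ), ∀ x : C, ψ.1 x < φ x + c ∧ φ x + c < ψ.1 x + ε := by
  rcases isEmpty_or_nonempty C with hemp | ⟨⟨x₀⟩⟩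
  · exact ⟨0, 0, fun x => isEmptyElim x⟩
  have : CompactSpace C := isCompact_iff_compactSpace.1 hC
  have hG : ∀ d : ℝ, IsCompact (range fun x : C => ((x : E), ψ.1 x + d)) := fun d =>
    isCompact_range (by fun_prop)
  have hGc : ∀ d : ℝ, Convex ℝ (range fun x : C => ((x : E), ψ.1 x + d)) := by
    rintro d _ ⟨x, rfl⟩ _ ⟨y, rfl⟩ a b ha hb hab
    refine ⟨⟨a • (x : E) + b • (y : E), hconv x.2 y.2 ha hb hab⟩, ?_⟩
    refine Prod.ext rfl ?_
    have := ψ.2 x y ⟨a • (x : E) + b • (y : E), hconv x.2 y.2 ha hb hab⟩ a b ha hb hab rfl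
    simp only [this, Prod.snd_add, Prod.smul_snd, smul_eq_mul]
    linear_combination (-d) * hab
  have hdisj : Disjoint (range fun x : C => ((x : E), ψ.1 x + 0))
      (range fun x : C => ((x : E), ψ.1 x + ε)) := by
    rw [Set.disjoint_left]
    rintro _ ⟨x, rfl⟩ ⟨y, hy⟩
    obtain ⟨h1, h2⟩ := Prod.ext_iff.1 hy
    obtain rfl : y = x := Subtype.ext h1
    exact hε.ne' (add_left_cancel h2)
  -- A hyperplane in `E × ℝ` strictly between the graphs of ψ and ψ + ε is itself the graph of the
  -- required function, provided it is not vertical, that is, `Φ (0, 1) ≠ 0`.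
  obtain ⟨Φ, u, v, hu, huv, hv⟩ := geometric_hahn_banach_compact_closed (hGc 0) (hG 0) (hGc ε)
    (hG ε).isClosed hdisj
  have hΦ : ∀ (y : E) (r : ℝ), Φ (y, r) = Φ (y, 0) + r * Φ (0, 1) := by
    intro y r
    have : ((y, r) : E × ℝ) = (y, 0) + r • (0, 1) := by simp
    rw [this, map_add, map_smul, smul_eq_mul]
  have hu' : ∀ x : C, Φ (x, 0) + ψ.1 x * Φ (0, 1) < u := fun x => by
    have := hu _ ⟨x, rfl⟩
    rwa [hΦ, add_zero] at this
  have hv' : ∀ x : C, v < Φ (x, 0) + (ψ.1 x + ε) * Φ (0, 1) := fun x => by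
    have := hv _ ⟨x, rfl⟩
    rwa [hΦ] at this
  have hk : 0 < Φ (0, 1) := by
    have := hu' x₀
    have := hv' x₀
    by_contra! hle
    nlinarith
  have hφ : ∀ x : E, (-(Φ (0, 1))⁻¹ • Φ.comp (.inl ℝ E ℝ)) x + u / Φ (0, 1)
      = (u - Φ (x, 0)) / Φ (0, 1) := by
    intro x
    change -(Φ (0, 1))⁻¹ * Φ (x, 0) + u / Φ (0, 1) = _
    ring
  refine ⟨-(Φ (0, 1))⁻¹ • Φ.comp (.inl ℝ E ℝ), u / Φ (0, 1), fun x => ?_⟩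
  rw [hφ, lt_div_iff₀ hk, div_lt_iff₀ hk]
  constructor
  · linarith [hu' x]
  · linarith [hv' x]

/-- Continuous affine functions commute with weak integrals of probability measures. -/
theorem HasWeakIntegral.integral_affine {𝕜 : Type*} [RCLike 𝕜] [Module 𝕜 E] [IsScalarTower ℝ 𝕜 E]
    [ContinuousSMul 𝕜 E] {X : Type*} [TopologicalSpace X] [MeasurableSpace X]
    [OpensMeasurableSpace X] {μ : Measure X} [IsProbabilityMeasure μ] {C : Set E}
    (hC : IsCompact C) (hconv : Convex ℝ C) {F : X → C} (hF : Continuous F) {v : C}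
    (h : HasWeakIntegral 𝕜 μ (fun x => (F x : E)) v) (ψ : affineFunctions C) :
    ∫ x, ψ.1 (F x) ∂μ = ψ.1 v := by
  have : CompactSpace C := isCompact_iff_compactSpace.1 hC
  have hint : ∀ χ : affineFunctions C, Integrable (fun x => χ.1 (F x)) μ := fun χ =>
    (BoundedContinuousFunction.ofNormedAddCommGroup (fun x => χ.1 (F x))
      (χ.1.continuous.comp hF) ‖χ.1‖ fun x => χ.1.norm_coe_le_norm _).integrable μ
  have hle : ∀ χ : affineFunctions C, ∫ x, χ.1 (F x) ∂μ ≤ χ.1 v := by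
    intro χ
    refine le_of_forall_pos_le_add fun ε hε => ?_
    obtain ⟨φ, c, hφ⟩ := exists_functional_near_affine hC hconv χ hε
    -- The weak integral is tested by 𝕜-linear functionals; the real `φ` is the real part of one of
    -- them.
    have hre : ∫ x, φ (F x) ∂μ = φ v := by
      obtain ⟨h1, h2⟩ := h (StrongDual.extendRCLike φ)
      have h3 := integral_re h1
      rw [h2] at h3
      simpa using h3
    have hφint : Integrable (fun x => φ (F x)) μ := hint (restrictFunctional C φ)
    calc ∫ x, χ.1 (F x) ∂μ ≤ ∫ x, (φ (F x) + c) ∂μ :=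
          integral_mono (hint χ) (hφint.add (integrable_const c)) fun x => (hφ (F x)).1.le
      _ = φ v + c := by rw [integral_add hφint (integrable_const c), hre]; simp
      _ ≤ χ.1 v + ε := (hφ v).2.le
  refine le_antisymm (hle ψ) ?_
  -- Affine functions are closed under negation, so the one-sided bound yields equality.
  have := hle (-ψ)
  simpa [integral_neg] using this

end AffineFunctions

/-! ### From an invariant mean to a fixed point -/

section FixedPoint

/-- A mean on a space of continuous affine functions, positive and normalized, is evaluation at a
point. -/
theorem exists_forall_affine_eq {E : Type*} [AddCommGroup E] [Module ℝ E] [TopologicalSpace E]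
    {C : Set E} (hC : IsCompact C) (hconv : Convex ℝ C)
    (M : affineFunctions C →ₗ[ℝ] ℝ)
    (hM : ∀ (ψ : affineFunctions C) (r : ℝ), (∀ x, ψ.1 x ≤ r) → M ψ ≤ r) :
    ∃ x : C, ∀ ψ : affineFunctions C, ψ.1 x = M ψ := by
  have : CompactSpace C := isCompact_iff_compactSpace.1 hC
  let Θ : C → affineFunctions C → ℝ := fun x ψ => ψ.1 x
  have hΘ : Continuous Θ := continuous_pi fun ψ => ψ.1.continuous
  have hΘc : Convex ℝ (range Θ) := by
    rintro _ ⟨x, rfl⟩ _ ⟨y, rfl⟩ a b ha hb hab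
    exact ⟨⟨a • (x : E) + b • (y : E), hconv x.2 y.2 ha hb hab⟩,
      funext fun ψ => ψ.2 x y _ a b ha hb hab rfl⟩
  suffices h : (fun ψ => M ψ) ∈ range Θ by
    obtain ⟨x, hx⟩ := h
    exact ⟨x, fun ψ => congrFun hx ψ⟩
  by_contra hmem
  obtain ⟨φ, r, hφ, hr⟩ := geometric_hahn_banach_closed_point hΘc
    (isCompact_range hΘ).isClosed hmem
  obtain ⟨J, c, hJ⟩ := exists_finset_sum_coord φ
  -- A functional separating `M` from the evaluations is a finite combination of coordinates, hence
  -- amounts to a single affine function: it is at most `r` on `C`, but `M` gives it a value above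
  -- `r`.
  refine absurd (hM (∑ j ∈ J, c j • j) r fun x => ?_) ?_
  · have := (hφ _ ⟨x, rfl⟩).le
    rw [hJ] at this
    simpa [Θ, mul_comm] using this
  · rw [hJ] at hr
    simpa [mul_comm] using hr

section OrbitFunction

variable {K C : Type*} [TopologicalSpace K] [TopologicalSpace C] [CompactSpace C]
  {π : K → C → C} (hπ : ∀ x, Continuous fun s => π s x)

/-- The bounded continuous function `s ↦ ψ (π s x)`. -/
noncomputable def orbitFunction (x : C) (ψ : C(C, ℝ)) : K →ᵇ ℂ :=
  BoundedContinuousFunction.ofNormedAddCommGroup (fun s => ((ψ (π s x) : ℝ) : ℂ))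
    (Complex.continuous_ofReal.comp (ψ.continuous.comp (hπ x))) ‖ψ‖ fun s => by
      rw [Complex.norm_real]
      exact ψ.norm_coe_le_norm _

/-- For an equicontinuous action, orbit functions depend continuously on the base point. -/
theorem continuous_orbitFunction (heq : IsEquicontinuousAction π) (ψ : C(C, ℝ)) :
    Continuous fun x => orbitFunction hπ x ψ := by
  refine continuous_iff_continuousAt.2 fun x => Metric.continuousAt_iff'.2 fun ε hε => ?_
  have hU : {q : C × C | dist (ψ q.1) (ψ q.2) < ε / 2} ∈ 𝓝ˢ (diagonal C) := by
    refine (isOpen_lt (by fun_prop) continuous_const).mem_nhdsSet.2 ?_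
    rintro ⟨a, b⟩ (rfl : a = b)
    simpa using hε
  obtain ⟨V, hV, h⟩ := heq x _ hU
  have hVx : {y | (x, y) ∈ V} ∈ 𝓝 x :=
    (Continuous.prodMk_right x).continuousAt.preimage_mem_nhds
      (mem_nhdsSet_iff_forall.1 hV (x, x) rfl)
  filter_upwards [hVx] with y hy
  refine lt_of_le_of_lt ((BoundedContinuousFunction.dist_le (C := ε / 2) (by positivity)).2
    fun s => ?_) (half_lt_self hε)
  rw [dist_comm]
  change dist ((ψ (π s x) : ℝ) : ℂ) ((ψ (π s y) : ℝ) : ℂ) ≤ _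
  rw [Complex.isometry_ofReal.dist_eq]
  exact (h y hy s).le

end OrbitFunction

variable {K : Type*} [TopologicalSpace K] [T2Space K] [LocallyCompactSpace K] [MeasurableSpace K]
  [BorelSpace K] {S : SemitopologicalSemihypergroup K}

namespace SemitopologicalSemihypergroup

/-- A mean does not exceed the upper bounds of real functions. -/
theorem IsMean.re_le [Nonempty K] {m : S.AP →L[ℂ] ℂ} (hm : S.IsMean m) (f : S.AP) (g : K → ℝ)
    {r : ℝ} (hfg : ∀ x, (f : K →ᵇ ℂ) x = g x) (hr : ∀ x, g x ≤ r) : (m f).re ≤ r := by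
  obtain ⟨hm1, hm2⟩ := hm
  have hg : ∀ x, |g x| ≤ ‖f‖ := fun x => by
    have := (f : K →ᵇ ℂ).norm_coe_le_norm x
    rwa [hfg, Complex.norm_real] at this
  -- `c` is the midpoint of `[-‖f‖, r]`, which contains all values of `g`. Hence ‖f - c‖ ≤ r - c,
  -- and `‖m‖ = 1` gives Re m(f) - c ≤ r - c.
  obtain ⟨c, hc⟩ : ∃ c : ℝ, c = (r - ‖f‖) / 2 := ⟨_, rfl⟩
  have hd : 0 ≤ r - c := by
    obtain ⟨x⟩ := ‹Nonempty K›
    linarith [(abs_le.1 (hg x)).1, hr x]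
  let h : S.AP := f - (c : ℂ) • ⟨1, S.one_mem_AP⟩
  have h1 : ‖h‖ ≤ r - c := by
    refine (BoundedContinuousFunction.norm_le (f := (h : K →ᵇ ℂ)) hd).2 fun x => ?_
    have hx : (h : K →ᵇ ℂ) x = ((g x - c : ℝ) : ℂ) := by
      change (f : K →ᵇ ℂ) x - (c : ℂ) * 1 = _
      rw [hfg, mul_one, Complex.ofReal_sub]
    rw [hx, Complex.norm_real, Real.norm_eq_abs, abs_le]
    have := abs_le.1 (hg x)
    constructor <;> linarith [hr x]
  have h2 : m h = m f - c := by
    change m (f - (c : ℂ) • ⟨1, S.one_mem_AP⟩) = _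
    rw [map_sub, map_smul, hm2, smul_eq_mul, mul_one]
  have h3 := (m.le_opNorm h).trans (mul_le_mul_of_nonneg_left h1 (norm_nonneg m))
  rw [hm1, one_mul, h2] at h3
  have h4 := (Complex.re_le_norm _).trans h3
  rw [Complex.sub_re, Complex.ofReal_re] at h4
  linarith

end SemitopologicalSemihypergroup

section Orbit

variable {E : Type*} [AddCommGroup E] [Module ℝ E] [TopologicalSpace E] {C : Set E}
  [CompactSpace C] {π : K → C → C} (hπ : ∀ x, Continuous fun s => π s x)
  [IsTopologicalAddGroup E] [ContinuousSMul ℝ E] [LocallyConvexSpace ℝ E] [T2Space E]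
  {𝕜 : Type*} [RCLike 𝕜] [Module 𝕜 E] [IsScalarTower ℝ 𝕜 E] [ContinuousSMul 𝕜 E]

/-- The left side is a translate of the orbit function: read in `s` it says that R_t moves the base
point from x to π_t x, read in `t` it says that L_s replaces ψ by ψ ∘ π_s. -/
theorem integral_orbitFunction (hconv : Convex ℝ C) (hact : IsAction 𝕜 S π) (x : C)
    (ψ : affineFunctions C) (s t : K) :
    ∫ z, orbitFunction hπ x ψ.1 z ∂(S.pp s t) = ((ψ.1 (π s (π t x)) : ℝ) : ℂ) := by
  change ∫ z, ((ψ.1 (π z x) : ℝ) : ℂ) ∂(S.pp s t) = _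
  rw [integral_complex_ofReal, (hact.integral s t x).integral_affine
    (isCompact_iff_compactSpace.2 inferInstance) hconv (hπ x) ψ]

/-- The right orbit consists of orbit functions with other base points, so it lies in the image of
the compact `C` under `continuous_orbitFunction`. -/
theorem orbitFunction_mem_AP (hconv : Convex ℝ C) (hact : IsAction 𝕜 S π)
    (heq : IsEquicontinuousAction π) (x : C) (ψ : affineFunctions C) :
    orbitFunction hπ x ψ.1 ∈ S.AP := by
  rw [S.mem_AP_iff_right]
  have hc := isCompact_range (continuous_orbitFunction hπ heq ψ.1)
  refine hc.of_isClosed_subset isClosed_closure (closure_minimal ?_ hc.isClosed)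
  rintro _ ⟨t, rfl⟩
  refine ⟨π t x, ?_⟩
  ext s
  exact (integral_orbitFunction hπ hconv hact x ψ s t).symm

end Orbit

theorem fixedPointProperty_of_leftAmenableAP {K : Type u} [Nonempty K] [TopologicalSpace K]
    [T2Space K] [LocallyCompactSpace K] [MeasurableSpace K] [BorelSpace K]
    {S : SemitopologicalSemihypergroup K} {𝕜 : Type} [RCLike 𝕜] (hS : S.LeftAmenableAP) :
    FixedPointProperty.{u, v} 𝕜 S := by
  intro E _ _ _ _ _ _ _ _ _ C hne hC hconv π hact hsep heq haff
  have : ContinuousSMul ℝ E := IsScalarTower.continuousSMul 𝕜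
  have : CompactSpace C := isCompact_iff_compactSpace.1 hC
  obtain ⟨m, hm, hinv⟩ := hS
  obtain ⟨x, hx⟩ := hne.to_subtype
  let x : C := ⟨x, hx⟩
  let Λ : affineFunctions C →ₗ[ℝ] S.AP :=
    { toFun := fun ψ => ⟨orbitFunction hsep.2 x ψ.1,
        orbitFunction_mem_AP hsep.2 hconv hact heq x ψ⟩
      map_add' := fun ψ χ => by
        ext s
        exact Complex.ofReal_add _ _
      map_smul' := fun c ψ => by
        ext s
        change ((c * ψ.1 (π s x) : ℝ) : ℂ) = c • ((ψ.1 (π s x) : ℝ) : ℂ)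
        rw [Complex.ofReal_mul, Complex.real_smul] }
  let M : affineFunctions C →ₗ[ℝ] ℝ :=
    { toFun := fun ψ => (m (Λ ψ)).re
      map_add' := fun ψ χ => by rw [map_add, map_add, Complex.add_re]
      map_smul' := fun c ψ => by
        have : Λ (c • ψ) = (c : ℂ) • Λ ψ := by
          rw [map_smul]
          rfl
        rw [this, map_smul, smul_eq_mul, Complex.re_ofReal_mul]
        rfl }
  obtain ⟨x₀, hx₀⟩ := exists_forall_affine_eq hC hconv M fun ψ r hψ =>
    hm.re_le (Λ ψ) (fun s => ψ.1 (π s x)) (fun _ => rfl) fun s => hψ _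
  refine ⟨x₀, fun t => ?_⟩
  by_contra hne
  obtain ⟨φ, hφ⟩ := geometric_hahn_banach_point_point fun h : (π t x₀ : E) = x₀ =>
    hne (Subtype.ext h)
  let ψ : affineFunctions C := restrictFunctional C φ
  -- `χ` is ψ ∘ π_t, whose orbit function is the left translate by `t` of that of `ψ`; the invariant
  -- mean cannot tell them apart.
  let χ : affineFunctions C := ⟨ψ.1.comp ⟨π t, hsep.1 t⟩, fun y z w a b ha hb hab hw =>
    ψ.2 _ _ _ a b ha hb hab (haff t y z w a b ha hb hab hw)⟩
  have h1 : m (Λ χ) = m (Λ ψ) := by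
    refine hinv t _ _ ?_
    ext s
    exact (integral_orbitFunction hsep.2 hconv hact x ψ t s).symm
  have h2 : χ.1 x₀ = ψ.1 x₀ := by
    rw [hx₀, hx₀]
    exact congrArg Complex.re h1
  exact hφ.ne h2

end FixedPoint

/-! ### From a fixed point to an invariant mean -/

section Means

variable {K : Type u} [TopologicalSpace K] [T2Space K] [LocallyCompactSpace K] [MeasurableSpace K]
  [BorelSpace K]

namespace SemitopologicalSemihypergroup

variable (S : SemitopologicalSemihypergroup K)

/-- The constant function `1` as an element of `AP(K)`. -/
noncomputable def oneAP : S.AP := ⟨1, S.one_mem_AP⟩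

theorem norm_oneAP_le : ‖S.oneAP‖ ≤ 1 :=
  (BoundedContinuousFunction.norm_le (f := (1 : K →ᵇ ℂ)) zero_le_one).2 fun _ => by simp

/-- Means on `AP(K)`, given by their real parts, in a power of the scalar field `𝕜`. -/
def meanSet (𝕜 : Type*) [RCLike 𝕜] : Set (ULift.{v} S.AP → 𝕜) :=
  {g | (∀ f, RCLike.im (g f) = 0) ∧
    (∀ (a : ℝ) (f h : S.AP), g ⟨a • f + h⟩ = (a : 𝕜) * g ⟨f⟩ + g ⟨h⟩) ∧
    (∀ f : S.AP, ‖g ⟨f⟩‖ ≤ ‖f‖) ∧ g ⟨S.oneAP⟩ = 1}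

variable {𝕜 : Type*} [RCLike 𝕜]

theorem convex_meanSet : Convex ℝ (S.meanSet.{u, v} 𝕜) := by
  rintro g ⟨g1, g2, g3, g4⟩ h ⟨h1, h2, h3, h4⟩ a b ha hb hab
  refine ⟨fun f => ?_, fun c f k => ?_, fun f => ?_, ?_⟩
  · simp [RCLike.smul_im, g1, h1]
  · simp only [Pi.add_apply, Pi.smul_apply, g2, h2, RCLike.real_smul_eq_coe_mul]
    ring
  · refine (norm_add_le _ _).trans ?_
    rw [Pi.smul_apply, Pi.smul_apply, norm_smul, norm_smul, Real.norm_of_nonneg ha,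
      Real.norm_of_nonneg hb]
    refine (add_le_add (mul_le_mul_of_nonneg_left (g3 f) ha)
      (mul_le_mul_of_nonneg_left (h3 f) hb)).trans_eq ?_
    rw [← add_mul, hab, one_mul]
  · simp only [Pi.add_apply, Pi.smul_apply, g4, h4]
    rw [← add_smul, hab, one_smul]

theorem isCompact_meanSet : IsCompact (S.meanSet.{u, v} 𝕜) := by
  have hc : IsCompact (Set.pi univ fun f : ULift.{v} S.AP => Metric.closedBall (0 : 𝕜) ‖f.down‖) :=
    isCompact_univ_pi fun f => isCompact_closedBall _ _
  refine hc.of_isClosed_subset ?_ ?_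
  · have e1 : IsClosed {g : ULift.{v} S.AP → 𝕜 | ∀ f, RCLike.im (g f) = 0} := by
      simp only [ofPred_forall]
      exact isClosed_iInter fun f => isClosed_eq
        (RCLike.continuous_im.comp (continuous_apply f)) continuous_const
    have e2 : IsClosed {g : ULift.{v} S.AP → 𝕜 | ∀ (a : ℝ) (f h : S.AP),
        g ⟨a • f + h⟩ = (a : 𝕜) * g ⟨f⟩ + g ⟨h⟩} := by
      simp only [ofPred_forall]
      exact isClosed_iInter fun a => isClosed_iInter fun f => isClosed_iInter fun h =>
        isClosed_eq (by fun_prop) (by fun_prop)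
    have e3 : IsClosed {g : ULift.{v} S.AP → 𝕜 | ∀ f : S.AP, ‖g ⟨f⟩‖ ≤ ‖f‖} := by
      simp only [ofPred_forall]
      exact isClosed_iInter fun f => isClosed_le (by fun_prop) continuous_const
    have e4 : IsClosed {g : ULift.{v} S.AP → 𝕜 | g ⟨S.oneAP⟩ = 1} :=
      isClosed_eq (by fun_prop) continuous_const
    exact e1.inter (e2.inter (e3.inter e4))
  · rintro g ⟨-, -, g3, -⟩ f -
    simpa using g3 f.down

theorem nonempty_meanSet [Nonempty K] : (S.meanSet.{u, v} 𝕜).Nonempty := by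
  obtain ⟨x⟩ := ‹Nonempty K›
  refine ⟨fun f => (((f.down : K →ᵇ ℂ) x).re : 𝕜), fun f => RCLike.ofReal_im _, fun a f h => ?_,
    fun f => ?_, ?_⟩
  · simp
  · rw [RCLike.norm_ofReal]
    exact (Complex.abs_re_le_norm _).trans ((f : K →ᵇ ℂ).norm_coe_le_norm x)
  · change (((1 : ℂ).re : ℝ) : 𝕜) = 1
    simp

/-- The real functional underlying an element of `meanSet`. -/
theorem exists_functional_of_mem_meanSet {g : ULift.{v} S.AP → 𝕜} (hg : g ∈ S.meanSet 𝕜) :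
    ∃ G : S.AP →L[ℝ] ℝ, ‖G‖ ≤ 1 ∧ G S.oneAP = 1 ∧ ∀ f : S.AP, g ⟨f⟩ = (G f : 𝕜) := by
  obtain ⟨g1, g2, g3, g4⟩ := hg
  have hre : ∀ f, g f = ((RCLike.re (g f) : ℝ) : 𝕜) := fun f =>
    RCLike.ext (by simp) (by simp [g1])
  have hzero : g ⟨0⟩ = 0 := by simpa using g3 0
  let G : S.AP →ₗ[ℝ] ℝ :=
    { toFun := fun f => RCLike.re (g ⟨f⟩)
      map_add' := fun f h => by
        have := g2 1 f h
        rw [one_smul] at this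
        simp [this]
      map_smul' := fun a f => by
        have := g2 a f 0
        rw [add_zero, hzero, add_zero] at this
        simp [this] }
  have hG : ∀ f, ‖G f‖ ≤ 1 * ‖f‖ := fun f => by
    rw [one_mul]
    exact (RCLike.norm_re_le_norm _).trans (g3 f)
  refine ⟨G.mkContinuous 1 hG, G.mkContinuous_norm_le zero_le_one hG, ?_, fun f => hre _⟩
  change RCLike.re (g ⟨S.oneAP⟩) = 1
  rw [g4, RCLike.one_re]

/-- Elements of `meanSet` are contractive. -/
theorem dist_le_of_mem_meanSet {g : ULift.{v} S.AP → 𝕜} (hg : g ∈ S.meanSet 𝕜) (f h : S.AP) :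
    dist (g ⟨f⟩) (g ⟨h⟩) ≤ dist f h := by
  obtain ⟨G, hG, -, hgG⟩ := S.exists_functional_of_mem_meanSet hg
  rw [dist_eq_norm, dist_eq_norm, hgG, hgG, ← RCLike.ofReal_sub, RCLike.norm_ofReal, ← map_sub]
  exact (G.le_opNorm _).trans (mul_le_of_le_one_left (norm_nonneg _) hG)

/-- A real functional invariant under translations extends to an invariant mean. -/
theorem leftAmenableAP_of_real {G : S.AP →L[ℝ] ℝ} (hG : ‖G‖ ≤ 1) (h1 : G S.oneAP = 1)
    (hinv : ∀ (x : K) (f g : S.AP), (g : K →ᵇ ℂ) = S.leftTranslate x f → G g = G f) :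
    S.LeftAmenableAP := by
  let m : S.AP →L[ℂ] ℂ := StrongDual.extendRCLike G
  have hm : ‖m‖ ≤ 1 := (StrongDual.norm_extendRCLike G).le.trans hG
  have hle : ‖m S.oneAP‖ ≤ 1 := (m.le_opNorm _).trans
    (mul_le_one₀ hm (norm_nonneg _) S.norm_oneAP_le)
  have hre : (m S.oneAP).re = 1 := by
    have := StrongDual.re_extendRCLike_apply (𝕜 := ℂ) G S.oneAP
    rwa [h1] at this
  have hm1 : m S.oneAP = 1 := by
    -- A complex number of modulus at most 1 with real part 1 is 1.
    refine Complex.ext hre ?_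
    have h2 : ‖m S.oneAP‖ ^ 2 ≤ 1 := pow_le_one₀ (norm_nonneg _) hle
    rw [Complex.sq_norm, Complex.normSq_apply, hre] at h2
    rw [Complex.one_im]
    nlinarith
  refine ⟨m, ⟨le_antisymm hm ?_, hm1⟩, fun x f g hfg => ?_⟩
  · have h2 := (m.le_opNorm S.oneAP).trans
      (mul_le_of_le_one_right (norm_nonneg m) S.norm_oneAP_le)
    rwa [hm1, norm_one] at h2
  -- The complex extension of `G` also involves its values at `I • f`, and `I • g` is again the
  -- translate of `I • f`.
  · have h2 : G (Complex.I • g) = G (Complex.I • f) := by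
      refine hinv x _ _ ?_
      rw [Submodule.coe_smul, Submodule.coe_smul, S.leftTranslate_smul, hfg]
    change StrongDual.extendRCLike G g = StrongDual.extendRCLike G f
    rw [StrongDual.extendRCLike_apply, StrongDual.extendRCLike_apply, hinv x f g hfg]
    change _ - Complex.I * ((G (Complex.I • g) : ℝ) : ℂ)
      = _ - Complex.I * ((G (Complex.I • f) : ℝ) : ℂ)
    rw [h2]

variable [Nonempty K]

/-- Left translation on `AP(K)`. -/
noncomputable def translateAP (s : K) (f : S.AP) : S.AP :=
  ⟨S.leftTranslate s f, S.leftTranslate_mem_AP s f.2⟩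

theorem continuous_translateAP (f : S.AP) : Continuous fun s => S.translateAP s f :=
  (S.continuous_leftTranslate_of_mem_AP f.2).subtype_mk _

theorem translateAP_smul_add (s : K) (a : ℝ) (f h : S.AP) :
    S.translateAP s (a • f + h) = a • S.translateAP s f + S.translateAP s h := by
  refine Subtype.ext ((S.leftTranslate_add s _ _).trans ?_)
  have : S.leftTranslate s ((a • f : S.AP) : K →ᵇ ℂ) = (a : ℂ) • S.leftTranslate s f :=
    S.leftTranslate_smul s a f
  rw [this]
  rfl

theorem norm_translateAP_le (s : K) (f : S.AP) : ‖S.translateAP s f‖ ≤ ‖f‖ :=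
  S.norm_leftTranslate_le s f

theorem totallyBounded_range_translateAP (f : S.AP) :
    TotallyBounded (range fun s => S.translateAP s f) := by
  have h := ((S.mem_AP_iff_left.1 f.2).totallyBounded.subset subset_closure)
  have := (totallyBounded_preimage (f := ((↑) : S.AP → K →ᵇ ℂ))
    isUniformEmbedding_subtype_val.isUniformInducing h)
  refine this.subset ?_
  rintro _ ⟨s, rfl⟩
  exact ⟨s, rfl⟩

/-- Continuous real functionals on `AP(K)` commute with the averaging of translates. -/
theorem integral_functional_translateAP (G : S.AP →L[ℝ] ℝ) (f : S.AP) (s t : K) :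
    ∫ z, G (S.translateAP z f) ∂(S.pp s t) = G (S.translateAP t (S.translateAP s f)) := by
  -- Extending `G` to all bounded continuous functions allows a Bochner integral in that complete
  -- space.
  obtain ⟨Ĝ, hĜ, -⟩ := exists_extension_norm_eq (S.AP.restrictScalars ℝ) G
  have hint : Integrable (fun z => S.leftTranslate z f) (S.pp s t) := by
    refine (integrable_const ‖(f : K →ᵇ ℂ)‖).mono' ?_
      (Eventually.of_forall fun z => S.norm_leftTranslate_le z f)
    borelize (K →ᵇ ℂ)
    -- `K` need not be second countable; separability of the range comes from the compact orbit
    -- closure.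
    refine aestronglyMeasurable_iff_aemeasurable_separable.2
      ⟨(S.continuous_leftTranslate_of_mem_AP f.2).measurable.aemeasurable, _,
        (S.mem_AP_iff_left.1 f.2).isSeparable, Eventually.of_forall fun z => subset_closure ⟨z, rfl⟩⟩
  have hval : ∫ z, S.leftTranslate z f ∂(S.pp s t)
      = S.leftTranslate t (S.leftTranslate s f) := by
    ext y
    rw [S.leftTranslate_leftTranslate_apply]
    exact ((BoundedContinuousFunction.evalCLM ℂ y).integral_comp_comm hint).symm
  have h := Ĝ.integral_comp_comm hint
  rw [hval] at h
  have hG : ∀ k : S.AP, Ĝ k = G k := fun k => hĜ k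
  rw [← hG]
  refine Eq.trans (integral_congr_ae (Eventually.of_forall fun z => ?_)) h
  exact (hG _).symm

/-- The action of `K` on means, dual to left translation. -/
noncomputable def meanAction (𝕜 : Type*) [RCLike 𝕜] (s : K) (g : S.meanSet.{u, v} 𝕜) :
    S.meanSet.{u, v} 𝕜 :=
  ⟨fun f => g.1 ⟨S.translateAP s f.down⟩, fun _ => g.2.1 _, fun a f h => by
    change g.1 ⟨S.translateAP s (a • f + h)⟩ = _
    rw [S.translateAP_smul_add]
    exact g.2.2.1 a _ _, fun f => (g.2.2.2.1 _).trans (S.norm_translateAP_le s f), by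
    refine Eq.trans ?_ g.2.2.2.2
    exact congrArg (fun k => g.1 ⟨k⟩) (Subtype.ext (S.leftTranslate_one s))⟩

theorem continuous_meanAction_right (g : S.meanSet.{u, v} 𝕜) :
    Continuous fun s => S.meanAction 𝕜 s g := by
  refine Continuous.subtype_mk (continuous_pi fun f => ?_) _
  obtain ⟨G, -, -, hG⟩ := S.exists_functional_of_mem_meanSet g.2
  simp only [hG]
  exact RCLike.continuous_ofReal.comp (G.continuous.comp (S.continuous_translateAP f.down))

theorem isSeparatelyContinuous_meanAction :
    IsSeparatelyContinuous (S.meanAction.{u, v} 𝕜) := by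
  refine ⟨fun s => ?_, S.continuous_meanAction_right⟩
  exact Continuous.subtype_mk (continuous_pi fun f =>
    (continuous_apply (ULift.up (S.translateAP s f.down))).comp continuous_subtype_val) _

theorem isAffineAction_meanAction : IsAffineAction (S.meanAction.{u, v} 𝕜) := by
  intro s g h k a b _ _ _ hk
  funext f
  exact congrFun hk _

/-- Continuous functionals on a power of 𝕜 are finite combinations of coordinates, so the weak
integral is checked at each `f`, where it is `integral_functional_translateAP`. Transposition
reverses order: π_s π_t corresponds to L_t L_s. -/
theorem isAction_meanAction : IsAction 𝕜 S (S.meanAction.{u, v} 𝕜) := by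
  refine ⟨fun s t g φ => ?_, fun e he g => ?_⟩
  · obtain ⟨G, -, -, hG⟩ := S.exists_functional_of_mem_meanSet g.2
    obtain ⟨J, c, hφ⟩ := exists_finset_sum_coord φ
    have hint : ∀ f : S.AP, Integrable (fun z => G (S.translateAP z f)) (S.pp s t) := by
      intro f
      refine (integrable_const (‖G‖ * ‖f‖)).mono'
        (G.continuous.comp (S.continuous_translateAP f)).aestronglyMeasurable
        (Eventually.of_forall fun z => (G.le_opNorm _).trans ?_)
      gcongr
      exact S.norm_translateAP_le z f
    have hint' : ∀ j : ULift.{v} S.AP, Integrable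
        (fun z => (S.meanAction 𝕜 z g : ULift.{v} S.AP → 𝕜) j) (S.pp s t) := by
      intro j
      refine (hint j.down).ofReal.congr (Eventually.of_forall fun z => ?_)
      exact (hG _).symm
    have hval : ∀ j : ULift.{v} S.AP,
        ∫ z, (S.meanAction 𝕜 z g : ULift.{v} S.AP → 𝕜) j ∂(S.pp s t)
          = (S.meanAction 𝕜 s (S.meanAction 𝕜 t g) : ULift.{v} S.AP → 𝕜) j := by
      intro j
      change ∫ z, g.1 ⟨S.translateAP z j.down⟩ ∂(S.pp s t)
        = g.1 ⟨S.translateAP t (S.translateAP s j.down)⟩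
      simp only [hG]
      rw [integral_ofReal, S.integral_functional_translateAP]
    simp only [hφ]
    refine ⟨integrable_finsetSum _ fun j _ => (hint' j).mul_const _, ?_⟩
    rw [integral_finsetSum _ fun j _ => (hint' j).mul_const _]
    exact Finset.sum_congr rfl fun j _ => by rw [integral_mul_const, hval]
  · refine Subtype.ext (funext fun f => ?_)
    have : S.translateAP e f.down = f.down := by
      refine Subtype.ext (BoundedContinuousFunction.ext fun y => ?_)
      change ∫ z, (f.down : K →ᵇ ℂ) z ∂(S.pp e y) = _
      rw [(he y).2, integral_dirac]
    change g.1 ⟨S.translateAP e f.down⟩ = _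
    rw [this]

/-- Means are contractive and the orbit of `f` is totally bounded, so closeness of two means on a
finite net of translates of `f` makes them close on all translates. The estimate is uniform in both
means. -/
theorem isEquicontinuousAction_meanAction :
    IsEquicontinuousAction (S.meanAction.{u, v} 𝕜) := by
  have : CompactSpace (S.meanSet.{u, v} 𝕜) := isCompact_iff_compactSpace.1 S.isCompact_meanSet
  have key : UniformEquicontinuous (S.meanAction.{u, v} 𝕜) := by
    rw [isUniformEmbedding_subtype_val.isUniformInducing.uniformEquicontinuous_iff]
    -- The product uniformity is the infimum of the pullbacks along coordinates, so each `f` is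
    -- treated separately.
    refine (uniformEquicontinuous_iInf_rng (u := fun f : ULift.{v} S.AP =>
      UniformSpace.comap (fun g : ULift.{v} S.AP → 𝕜 => g f) inferInstance)).2 fun f => ?_
    rintro _ ⟨V, hV, hVU⟩
    obtain ⟨ε, hε, hεV⟩ := Metric.mem_uniformity_dist.1 hV
    obtain ⟨J, hJ⟩ := exists_finite_net (S.totallyBounded_range_translateAP f.down)
      (show 0 < ε / 3 by positivity)
    have hu : ∀ i ∈ J, ∀ᶠ q : S.meanSet.{u, v} 𝕜 × S.meanSet.{u, v} 𝕜 in uniformity _,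
        dist (q.1.1 ⟨S.translateAP i f.down⟩) (q.2.1 ⟨S.translateAP i f.down⟩) < ε / 3 :=
      fun i _ => ((Pi.uniformContinuous_proj (fun _ : ULift.{v} S.AP => 𝕜)
        ⟨S.translateAP i f.down⟩).comp uniformContinuous_subtype_val)
        (Metric.dist_mem_uniformity (show 0 < ε / 3 by positivity))
    filter_upwards [(Finset.eventually_all J).2 hu] with q hq s
    refine hVU (hεV ?_)
    obtain ⟨i, hi, hsi⟩ := hJ s
    change dist (q.1.1 ⟨S.translateAP s f.down⟩) (q.2.1 ⟨S.translateAP s f.down⟩) < ε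
    have h1 := (S.dist_le_of_mem_meanSet q.1.2 (S.translateAP s f.down)
      (S.translateAP i f.down)).trans_lt hsi
    have h2 := (S.dist_le_of_mem_meanSet q.2.2 (S.translateAP s f.down)
      (S.translateAP i f.down)).trans_lt hsi
    rw [dist_comm] at h2
    have h3 := hq i hi
    have h4 := dist_triangle4 (q.1.1 ⟨S.translateAP s f.down⟩) (q.1.1 ⟨S.translateAP i f.down⟩)
      (q.2.1 ⟨S.translateAP i f.down⟩) (q.2.1 ⟨S.translateAP s f.down⟩)
    linarith
  intro g U hU
  rw [nhdsSet_diagonal_eq_uniformity] at hU ⊢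
  exact ⟨_, key U hU, fun h hh s => hh s⟩

end SemitopologicalSemihypergroup

theorem leftAmenableAP_of_fixedPointProperty [Nonempty K] {S : SemitopologicalSemihypergroup K}
    {𝕜 : Type} [RCLike 𝕜] (h : FixedPointProperty.{u, max u v} 𝕜 S) : S.LeftAmenableAP := by
  -- `ULift` only raises the power of 𝕜 to the universe `max u v` over which `h` quantifies.
  obtain ⟨g, hg⟩ := h (ULift.{v} S.AP → 𝕜) (S.meanSet.{u, v} 𝕜) S.nonempty_meanSet
    S.isCompact_meanSet S.convex_meanSet (S.meanAction 𝕜) S.isAction_meanAction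
    S.isSeparatelyContinuous_meanAction S.isEquicontinuousAction_meanAction
    S.isAffineAction_meanAction
  obtain ⟨G, hG, hG1, hgG⟩ := S.exists_functional_of_mem_meanSet g.2
  refine S.leftAmenableAP_of_real hG hG1 fun x f k hk => ?_
  have hk' : k = S.translateAP x f := Subtype.ext hk
  have h1 : g.1 ⟨S.translateAP x f⟩ = g.1 ⟨f⟩ := congrFun (congrArg Subtype.val (hg x)) ⟨f⟩
  rw [hgG, hgG, RCLike.ofReal_inj] at h1
  rw [hk', h1]

end Means

end SemiHyp

theorem theorem3p3 (𝕜 : Type) [RCLike 𝕜] {K : Type u} [Nonempty K] [TopologicalSpace K]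
    [T2Space K] [LocallyCompactSpace K] [MeasurableSpace K] [BorelSpace K]
    (S : SemiHyp.SemitopologicalSemihypergroup K) :
    S.LeftAmenableAP ↔ SemiHyp.FixedPointProperty.{u, max u v} 𝕜 S :=
  ⟨SemiHyp.fixedPointProperty_of_leftAmenableAP, SemiHyp.leftAmenableAP_of_fixedPointProperty⟩
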